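/- Let $M$ be a smooth manifold of dimension $n\ge 3$ with a smooth pseudo-Riemannian metric $g$ of any signature and Levi-Civita connection $\nabla$. The curvature conventions are $\nabla_j\nabla_k\omega_l-\nabla_k\nabla_j\omega_l=R_{jkl}{}^m\omega_m$, $R_{kl}=R_{kml}{}^m$, $R=R^m{}_m$. Put $G_{jklm}=g_{mj}g_{kl}-g_{mk}g_{jl}$, and let $$C_{jklm}=R_{jklm}+\tfrac{1}{n-2}\left(g_{jm}R_{kl}-g_{km}R_{jl}+R_{jm}g_{kl}-R_{km}g_{jl}\right)-\tfrac{R}{(n-1)(n-2)}\left(g_{jm}g_{kl}-g_{km}g_{jl}\right)$$ be the Weyl tensor. Suppose that $(M,g)$ is extended recurrent: there are a smooth closed one-form $A_i$ and smooth functions $\psi$ and $\beta$, with $\beta$ nowhere zero, such that $$\nabla_iR_{jklm}=A_iR_{jklm}+(\beta-\psi)A_iG_{jklm}+\tfrac{\beta}{2}\left[A_jG_{iklm}+A_kG_{jilm}+A_lG_{jkim}+A_mG_{jkli}\right].$$ (The further conditions that $\psi$ has no zeros and that $\nabla_j\psi=\beta A_j$, usually part of the definition, are not needed.) Write $A^2=g^{ij}A_iA_j$.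 1. At every point where $A^2\ne0$ one has $C_{jklm}=0$. If moreover $n>3$, then at every such point $$R_{kl}=a\,g_{kl}+b\,\frac{A_kA_l}{A^2},\qquad a=\frac{R-\psi(n-1)(n-2)}{2(n-1)},\qquad b=\frac{n-2}{2(n-1)}\left[R+\psi n(n-1)\right]$$ (the quasi-Einstein condition), and $$R_{jklm}=\frac{b}{n-2}\left[-g_{jm}\frac{A_kA_l}{A^2}+g_{km}\frac{A_jA_l}{A^2}-g_{kl}\frac{A_jA_m}{A^2}+g_{jl}\frac{A_kA_m}{A^2}\right]+\psi\left(g_{jm}g_{kl}-g_{jl}g_{km}\right).$$ 2. If $n>3$ and $A^2\neq0$ everywhere, then $(M,g)$ is conformally flat (its Weyl tensor vanishes) and is a space of quasi-constant curvature in the sense of Chen and Yano: there are a smooth one-form $V$ with $V^2=g^{ij}V_iV_j$ nowhere zero and smooth functions $p,q$ with $$R_{jklm}=p\,G_{jklm}+\frac{q}{V^2}\left(g_{jm}V_kV_l-g_{km}V_jV_l+g_{kl}V_jV_m-g_{jl}V_kV_m\right).$$ -/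

import Mathlib

open scoped Manifold ContDiff

noncomputable section

namespace ExtRec

/-- Coordinate space `ℝⁿ`. -/
abbrev Coord (n : ℕ) : Type := EuclideanSpace ℝ (Fin n)

/-- The partial derivative `∂f/∂uⁱ` at the point `u` of coordinate space. -/
def pd {n : ℕ} (i : Fin n) (f : Coord n → ℝ) (u : Coord n) : ℝ :=
  fderiv ℝ f u (EuclideanSpace.single i 1)

section Manifold

variable {n : ℕ} {M : Type*} [TopologicalSpace M] [ChartedSpace (Coord n) M]

/-- The smooth coordinate charts of `M` (all charts of the maximal smooth atlas). -/
def charts (n : ℕ) (M : Type*) [TopologicalSpace M] [ChartedSpace (Coord n) M] :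
    Set (OpenPartialHomeomorph M (Coord n)) :=
  IsManifold.maximalAtlas (𝓡 n) ∞ M

/-- The coordinate vector `∂/∂uⁱ` of the chart `e`, at the point of `M` with coordinates `u`. -/
def frame (e : OpenPartialHomeomorph M (Coord n)) (u : Coord n) (i : Fin n) :
    TangentSpace (𝓡 n) (e.symm u) :=
  mfderiv (𝓡 n) (𝓡 n) e.symm u (EuclideanSpace.single i (1 : ℝ) : Coord n)

/-- A smooth pseudo-Riemannian metric: a smooth field of nondegenerate symmetric bilinear forms
on the tangent spaces, of any signature. Smooth means that the components in every smooth chart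
are smooth. -/
structure PseudoRiemannianMetric (n : ℕ) (M : Type*) [TopologicalSpace M]
    [ChartedSpace (Coord n) M] where
  /-- The bilinear form on each tangent space. -/
  val : ∀ x : M, TangentSpace (𝓡 n) x →ₗ[ℝ] TangentSpace (𝓡 n) x →ₗ[ℝ] ℝ
  symm : ∀ (x : M) (v w : TangentSpace (𝓡 n) x), val x v w = val x w v
  nondegenerate : ∀ (x : M) (v : TangentSpace (𝓡 n) x), (∀ w, val x v w = 0) → v = 0
  smooth : ∀ e ∈ charts n M, ∀ i j : Fin n,
    ContDiffOn ℝ ∞ (fun u => val (e.symm u) (frame e u i) (frame e u j)) e.target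

/-- A smooth one-form (covector field). -/
structure OneForm (n : ℕ) (M : Type*) [TopologicalSpace M] [ChartedSpace (Coord n) M] where
  /-- The linear form on each tangent space. -/
  val : ∀ x : M, TangentSpace (𝓡 n) x →ₗ[ℝ] ℝ
  smooth : ∀ e ∈ charts n M, ∀ i : Fin n,
    ContDiffOn ℝ ∞ (fun u => val (e.symm u) (frame e u i)) e.target

/-- The components `A_i` of a one-form in the chart `e`, as functions of the coordinates. -/
def OneForm.comp (A : OneForm n M) (e : OpenPartialHomeomorph M (Coord n)) (i : Fin n)
    (u : Coord n) : ℝ :=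
  A.val (e.symm u) (frame e u i)

/-- The one-form is closed: `∂_i A_j = ∂_j A_i` in every chart. -/
def OneForm.IsClosed (A : OneForm n M) : Prop :=
  ∀ e ∈ charts n M, ∀ u ∈ e.target, ∀ i j : Fin n, pd i (A.comp e j) u = pd j (A.comp e i) u

namespace PseudoRiemannianMetric

variable (g : PseudoRiemannianMetric n M) (e : OpenPartialHomeomorph M (Coord n))

/-- The components `g_{ij}` in the chart `e`. -/
def lower (i j : Fin n) (u : Coord n) : ℝ :=
  g.val (e.symm u) (frame e u i) (frame e u j)

/-- The components `g^{ij}` of the inverse metric. -/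
def upper (i j : Fin n) (u : Coord n) : ℝ :=
  (Matrix.of (fun k l : Fin n => g.lower e k l u))⁻¹ i j

/-- The Christoffel symbols `Γ^k_{ij}` of the Levi-Civita connection. -/
def christoffel (k i j : Fin n) (u : Coord n) : ℝ :=
  1 / 2 * ∑ p, g.upper e k p u *
    (pd i (g.lower e p j) u + pd j (g.lower e p i) u - pd p (g.lower e i j) u)

/-- The mixed curvature components `R_{jkl}{}^m`, normalised by
`∇_j ∇_k ω_l - ∇_k ∇_j ω_l = R_{jkl}{}^m ω_m`. -/
def riemannMixed (j k l m : Fin n) (u : Coord n) : ℝ :=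
  pd k (g.christoffel e m j l) u - pd j (g.christoffel e m k l) u
    + ∑ p, (g.christoffel e p j l u * g.christoffel e m p k u
      - g.christoffel e p k l u * g.christoffel e m p j u)

/-- The Riemann tensor `R_{jklm} = R_{jkl}{}^p g_{pm}`. -/
def riemann (j k l m : Fin n) (u : Coord n) : ℝ :=
  ∑ p, g.riemannMixed e j k l p u * g.lower e p m u

/-- The Ricci tensor `R_{kl} = R_{kml}{}^m`. -/
def ricci (k l : Fin n) (u : Coord n) : ℝ :=
  ∑ m, g.riemannMixed e k m l m u

/-- The scalar curvature `R = g^{kl} R_{kl}`. -/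
def scalar (u : Coord n) : ℝ :=
  ∑ k, ∑ l, g.upper e k l u * g.ricci e k l u

/-- The covariant derivative `∇_i R_{jklm}` of the Riemann tensor. -/
def covRiemann (i j k l m : Fin n) (u : Coord n) : ℝ :=
  pd i (g.riemann e j k l m) u
    - ∑ p, (g.christoffel e p i j u * g.riemann e p k l m u
      + g.christoffel e p i k u * g.riemann e j p l m u
      + g.christoffel e p i l u * g.riemann e j k p m u
      + g.christoffel e p i m u * g.riemann e j k l p u)

/-- `G_{jklm} = g_{mj} g_{kl} - g_{mk} g_{jl}`. -/
def G (j k l m : Fin n) (u : Coord n) : ℝ :=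
  g.lower e m j u * g.lower e k l u - g.lower e m k u * g.lower e j l u

/-- The Weyl conformal curvature tensor `C_{jklm}`. -/
def weyl (j k l m : Fin n) (u : Coord n) : ℝ :=
  g.riemann e j k l m u
    + 1 / ((n : ℝ) - 2) * (g.lower e j m u * g.ricci e k l u - g.lower e k m u * g.ricci e j l u
      + g.ricci e j m u * g.lower e k l u - g.ricci e k m u * g.lower e j l u)
    - (g.lower e j m u * g.lower e k l u - g.lower e k m u * g.lower e j l u)
      / (((n : ℝ) - 1) * ((n : ℝ) - 2)) * g.scalar e u

/-- `A² = g^{ij} A_i A_j`. -/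
def normSq (A : OneForm n M) (u : Coord n) : ℝ :=
  ∑ i, ∑ j, g.upper e i j u * A.comp e i u * A.comp e j u

/-- `A_k A_l / A²`. -/
def unitSq (A : OneForm n M) (k l : Fin n) (u : Coord n) : ℝ :=
  A.comp e k u * A.comp e l u / g.normSq e A u

/-- Conformal flatness, as the vanishing of the Weyl tensor (used in dimension at least `4`). -/
def IsConformallyFlat : Prop :=
  ∀ e ∈ charts n M, ∀ u ∈ e.target, ∀ j k l m : Fin n, g.weyl e j k l m u = 0

/-- The curvature has, at coordinates `u`, the quasi-constant form with direction `V` and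
coefficients `p`, `q`:
`R_{jklm} = p G_{jklm} + q (g_{jm} V_k V_l - g_{km} V_j V_l + g_{kl} V_j V_m - g_{jl} V_k V_m) / V²`.
-/
def QuasiConstantForm (V : OneForm n M) (p q : ℝ) (u : Coord n) : Prop :=
  ∀ j k l m : Fin n, g.riemann e j k l m u = p * g.G e j k l m u
    + q * (g.lower e j m u * g.unitSq e V k l u - g.lower e k m u * g.unitSq e V j l u
      + g.lower e k l u * g.unitSq e V j m u - g.lower e j l u * g.unitSq e V k m u)

/-- A space of quasi-constant curvature (Chen-Yano): for some smooth nowhere null one-form `V`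
the curvature has the quasi-constant form, with smooth scalar coefficients `p`, `q`. The
coefficients are written in each chart; for `n ≥ 3` they are determined by the curvature tensor
and `V`, so those of different charts agree. -/
def IsQuasiConstantCurvature : Prop :=
  ∃ V : OneForm n M, ∀ e ∈ charts n M,
    (∀ u ∈ e.target, g.normSq e V u ≠ 0) ∧
    ∃ p q : Coord n → ℝ, ContDiffOn ℝ ∞ p e.target ∧ ContDiffOn ℝ ∞ q e.target ∧
      ∀ u ∈ e.target, g.QuasiConstantForm e V (p u) (q u) u

/-- The data of an extended recurrent structure: smooth functions `β` (nowhere zero) and `ψ`, a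
closed one-form `A`, and the recurrence equation for `∇_i R_{jklm}` in every chart. The usual
additional conditions `ψ ≠ 0` and `∇_j ψ = β A_j` are not imposed. -/
structure IsExtendedRecurrent (A : OneForm n M) (β ψ : M → ℝ) : Prop where
  smooth_β : ContMDiff (𝓡 n) 𝓘(ℝ) ∞ β
  smooth_ψ : ContMDiff (𝓡 n) 𝓘(ℝ) ∞ ψ
  β_ne_zero : ∀ x, β x ≠ 0
  closed : A.IsClosed
  recurrence : ∀ e ∈ charts n M, ∀ u ∈ e.target, ∀ i j k l m : Fin n,
    g.covRiemann e i j k l m u =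
      A.comp e i u * g.riemann e j k l m u
      + (β (e.symm u) - ψ (e.symm u)) * A.comp e i u * g.G e j k l m u
      + β (e.symm u) / 2 *
        (A.comp e j u * g.G e i k l m u + A.comp e k u * g.G e j i l m u
          + A.comp e l u * g.G e j k i m u + A.comp e m u * g.G e j k l i u)

/-- `a = (R - ψ (n-1)(n-2)) / (2 (n-1))`. -/
def coeffA (ψ : M → ℝ) (u : Coord n) : ℝ :=
  (g.scalar e u - ψ (e.symm u) * ((n : ℝ) - 1) * ((n : ℝ) - 2)) / (2 * ((n : ℝ) - 1))

/-- `b = (n-2) / (2 (n-1)) * (R + ψ n (n-1))`. -/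
def coeffB (ψ : M → ℝ) (u : Coord n) : ℝ :=
  ((n : ℝ) - 2) / (2 * ((n : ℝ) - 1)) *
    (g.scalar e u + ψ (e.symm u) * (n : ℝ) * ((n : ℝ) - 1))

end PseudoRiemannianMetric

end Manifold

end ExtRec

end

noncomputable section

namespace ExtRec

section PartialDerivatives

variable {n : ℕ} {U : Set (Coord n)} {u : Coord n} {f h : Coord n → ℝ}

lemma differentiableAt_of_contDiffOn (hU : IsOpen U) (hf : ContDiffOn ℝ ∞ f U) (hu : u ∈ U) :
    DifferentiableAt ℝ f u :=
  (hf.contDiffAt (hU.mem_nhds hu)).differentiableAt (by simp)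

lemma pd_congr (hU : IsOpen U) (hu : u ∈ U) (i : Fin n) (hfh : ∀ v ∈ U, f v = h v) :
    pd i f u = pd i h u := by
  unfold pd
  rw [Filter.EventuallyEq.fderiv_eq (Filter.eventuallyEq_of_mem (hU.mem_nhds hu) hfh)]

lemma pd_const (i : Fin n) (c : ℝ) : pd i (fun _ => c) u = 0 := by
  simp [pd]

lemma pd_add (i : Fin n) (hf : DifferentiableAt ℝ f u) (hh : DifferentiableAt ℝ h u) :
    pd i (fun v => f v + h v) u = pd i f u + pd i h u := by
  unfold pd
  rw [fderiv_fun_add hf hh]; rfl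

lemma pd_sub (i : Fin n) (hf : DifferentiableAt ℝ f u) (hh : DifferentiableAt ℝ h u) :
    pd i (fun v => f v - h v) u = pd i f u - pd i h u := by
  unfold pd
  rw [fderiv_fun_sub hf hh]; rfl

lemma pd_mul (i : Fin n) (hf : DifferentiableAt ℝ f u) (hh : DifferentiableAt ℝ h u) :
    pd i (fun v => f v * h v) u = pd i f u * h u + f u * pd i h u := by
  unfold pd
  rw [fderiv_fun_mul hf hh]
  simp only [add_apply, smul_apply, smul_eq_mul]
  ring

lemma pd_sum {ι : Type*} (s : Finset ι) (i : Fin n) {F : ι → Coord n → ℝ}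
    (hF : ∀ p ∈ s, DifferentiableAt ℝ (F p) u) :
    pd i (fun v => ∑ p ∈ s, F p v) u = ∑ p ∈ s, pd i (F p) u := by
  unfold pd
  rw [fderiv_fun_sum hF]
  simp

lemma contDiffOn_pd (hU : IsOpen U) (i : Fin n) (hf : ContDiffOn ℝ ∞ f U) :
    ContDiffOn ℝ ∞ (pd i f) U :=
  (hf.fderiv_of_isOpen hU (by simp)).clm_apply contDiffOn_const

lemma pd_comm (hU : IsOpen U) (hu : u ∈ U) (i j : Fin n) (hf : ContDiffOn ℝ ∞ f U) :
    pd i (pd j f) u = pd j (pd i f) u := by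
  have hat := hf.contDiffAt (hU.mem_nhds hu)
  have hd : DifferentiableAt ℝ (fderiv ℝ f) u :=
    ((hf.fderiv_of_isOpen hU (m := ∞) (by simp)).contDiffAt (hU.mem_nhds hu)).differentiableAt
      (by simp)
  have hs : IsSymmSndFDerivAt ℝ f u := hat.isSymmSndFDerivAt (by
    rw [minSmoothness_of_isRCLikeNormedField]
    exact WithTop.coe_le_coe.mpr (le_top : (2 : ℕ∞) ≤ ⊤))
  have key : ∀ a b : Fin n, pd a (pd b f) u =
      fderiv ℝ (fderiv ℝ f) u (EuclideanSpace.single a 1) (EuclideanSpace.single b 1) := by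
    intro a b
    change fderiv ℝ (fun v => fderiv ℝ f v (EuclideanSpace.single b 1)) u _ = _
    rw [fderiv_clm_apply hd (differentiableAt_const _)]
    simp
  rw [key, key, hs.eq]

/-- Entrywise partial derivative of a matrix-valued function. -/
def matPd (i : Fin n) (X : Coord n → Matrix (Fin n) (Fin n) ℝ) (u : Coord n) :
    Matrix (Fin n) (Fin n) ℝ :=
  Matrix.of fun a b => pd i (fun v => X v a b) u

/-- Entrywise smoothness of a matrix-valued function. -/
def MatSmoothOn (X : Coord n → Matrix (Fin n) (Fin n) ℝ) (U : Set (Coord n)) : Prop :=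
  ∀ a b, ContDiffOn ℝ ∞ (fun v => X v a b) U

variable {X Y : Coord n → Matrix (Fin n) (Fin n) ℝ}

lemma MatSmoothOn.mul (hX : MatSmoothOn X U) (hY : MatSmoothOn Y U) :
    MatSmoothOn (fun v => X v * Y v) U := by
  intro a b
  simp only [Matrix.mul_apply]
  exact ContDiffOn.sum fun p _ => (hX a p).mul (hY p b)

lemma MatSmoothOn.sub (hX : MatSmoothOn X U) (hY : MatSmoothOn Y U) :
    MatSmoothOn (fun v => X v - Y v) U :=
  fun a b => (hX a b).sub (hY a b)

lemma MatSmoothOn.add (hX : MatSmoothOn X U) (hY : MatSmoothOn Y U) :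
    MatSmoothOn (fun v => X v + Y v) U :=
  fun a b => (hX a b).add (hY a b)

lemma MatSmoothOn.transpose (hX : MatSmoothOn X U) : MatSmoothOn (fun v => (X v).transpose) U :=
  fun a b => hX b a

lemma MatSmoothOn.matPd (hU : IsOpen U) (i : Fin n) (hX : MatSmoothOn X U) :
    MatSmoothOn (ExtRec.matPd i X) U :=
  fun a b => contDiffOn_pd hU i (hX a b)

lemma matPd_congr (hU : IsOpen U) (hu : u ∈ U) (i : Fin n) (hXY : ∀ v ∈ U, X v = Y v) :
    matPd i X u = matPd i Y u := by
  ext a b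
  exact pd_congr hU hu i fun v hv => by rw [hXY v hv]

lemma matPd_transpose (i : Fin n) : matPd i (fun v => (X v).transpose) u = (matPd i X u).transpose :=
  rfl

lemma matPd_add (hU : IsOpen U) (hu : u ∈ U) (i : Fin n) (hX : MatSmoothOn X U)
    (hY : MatSmoothOn Y U) :
    matPd i (fun v => X v + Y v) u = matPd i X u + matPd i Y u := by
  ext a b
  exact pd_add i (differentiableAt_of_contDiffOn hU (hX a b) hu)
    (differentiableAt_of_contDiffOn hU (hY a b) hu)

lemma matPd_sub (hU : IsOpen U) (hu : u ∈ U) (i : Fin n) (hX : MatSmoothOn X U)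
    (hY : MatSmoothOn Y U) :
    matPd i (fun v => X v - Y v) u = matPd i X u - matPd i Y u := by
  ext a b
  exact pd_sub i (differentiableAt_of_contDiffOn hU (hX a b) hu)
    (differentiableAt_of_contDiffOn hU (hY a b) hu)

lemma matPd_mul (hU : IsOpen U) (hu : u ∈ U) (i : Fin n) (hX : MatSmoothOn X U)
    (hY : MatSmoothOn Y U) :
    matPd i (fun v => X v * Y v) u = matPd i X u * Y u + X u * matPd i Y u := by
  ext a b
  have hX' := fun p => differentiableAt_of_contDiffOn hU (hX a p) hu
  have hY' := fun p => differentiableAt_of_contDiffOn hU (hY p b) hu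
  simp only [matPd, Matrix.mul_apply, Matrix.of_apply, Matrix.add_apply]
  rw [pd_sum Finset.univ i (F := fun p v => X v a p * Y v p b)
    fun p _ => (hX' p).fun_mul (hY' p), ← Finset.sum_add_distrib]
  exact Finset.sum_congr rfl fun p _ => pd_mul i (hX' p) (hY' p)

lemma matPd_comm (hU : IsOpen U) (hu : u ∈ U) (i j : Fin n) (hX : MatSmoothOn X U) :
    matPd i (matPd j X) u = matPd j (matPd i X) u := by
  ext a b
  exact pd_comm hU hu i j (hX a b)

end PartialDerivatives

section Frame

variable {n : ℕ} {M : Type*} [TopologicalSpace M] [ChartedSpace (Coord n) M]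
  {e : OpenPartialHomeomorph M (Coord n)} {u : Coord n}

lemma mfderiv_chart_symm_bijective [IsManifold (𝓡 n) ∞ M] (he : e ∈ charts n M)
    (hu : u ∈ e.target) : Function.Bijective (mfderiv (𝓡 n) (𝓡 n) e.symm u) := by
  have hd : e.MDifferentiable (𝓡 n) (𝓡 n) :=
    ⟨(contMDiffOn_of_mem_maximalAtlas he).mdifferentiableOn (by simp),
      (contMDiffOn_symm_of_mem_maximalAtlas he).mdifferentiableOn (by simp)⟩
  exact hd.symm.mfderiv_bijective hu

lemma sum_smul_frame (c : Fin n → ℝ) :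
    ∑ j, c j • frame e u j = mfderiv (𝓡 n) (𝓡 n) e.symm u (WithLp.toLp 2 c : Coord n) := by
  have hc : (WithLp.toLp 2 c : Coord n) = ∑ j, c j • EuclideanSpace.single j (1 : ℝ) := by
    ext k
    simp [Pi.single_apply]
  let L : Coord n →L[ℝ] TangentSpace (𝓡 n) (e.symm u) := mfderiv (𝓡 n) (𝓡 n) e.symm u
  change ∑ j, c j • L (EuclideanSpace.single j 1) = L (WithLp.toLp 2 c)
  rw [hc, map_sum]
  exact Finset.sum_congr rfl fun j _ => (map_smul _ _ _).symm

lemma contDiffOn_comp_chart_symm (he : e ∈ charts n M) {ψ : M → ℝ}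
    [IsManifold (𝓡 n) ∞ M]
    (hψ : ContMDiff (𝓡 n) 𝓘(ℝ) ∞ ψ) : ContDiffOn ℝ ∞ (fun u => ψ (e.symm u)) e.target :=
  (hψ.comp_contMDiffOn (contMDiffOn_symm_of_mem_maximalAtlas he)).contDiffOn

end Frame

namespace PseudoRiemannianMetric

variable {n : ℕ} {M : Type*} [TopologicalSpace M] [ChartedSpace (Coord n) M]
  (g : PseudoRiemannianMetric n M) (e : OpenPartialHomeomorph M (Coord n))

/-- The Gram matrix of the metric in the chart `e`. -/
def gram (u : Coord n) : Matrix (Fin n) (Fin n) ℝ := Matrix.of fun k l => g.lower e k l u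

variable {e}

lemma lower_symm (i j : Fin n) (u : Coord n) : g.lower e i j u = g.lower e j i u := g.symm _ _ _

lemma gram_transpose (u : Coord n) : (g.gram e u).transpose = g.gram e u := by
  ext i j; exact g.lower_symm j i u

lemma isUnit_det_gram [IsManifold (𝓡 n) ∞ M] (he : e ∈ charts n M) {u : Coord n}
    (hu : u ∈ e.target) : IsUnit (g.gram e u).det := by
  rw [isUnit_iff_ne_zero]
  intro h0
  obtain ⟨c, hc, hgc⟩ := Matrix.exists_mulVec_eq_zero_iff.mpr h0
  have hb := mfderiv_chart_symm_bijective he hu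
  apply hc
  have hv : mfderiv (𝓡 n) (𝓡 n) e.symm u (WithLp.toLp 2 c : Coord n) = 0 := by
    apply g.nondegenerate
    intro w
    obtain ⟨d, rfl⟩ := hb.2 w
    have hd : (d : Coord n) = WithLp.toLp 2 (WithLp.ofLp (d : Coord n)) := rfl
    generalize WithLp.ofLp (d : Coord n) = d' at hd
    subst hd
    rw [ ← sum_smul_frame, ← sum_smul_frame, g.symm]
    simp only [map_sum, LinearMap.sum_apply, map_smul, LinearMap.smul_apply, smul_eq_mul]
    simp only [Finset.mul_sum]
    rw [Finset.sum_comm]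
    refine Finset.sum_eq_zero fun i _ => ?_
    have := congrFun hgc i
    simp only [Matrix.mulVec, dotProduct, gram, Matrix.of_apply, Pi.zero_apply, lower] at this
    rw [← mul_zero (d' i), ← this, Finset.mul_sum]
    exact Finset.sum_congr rfl fun j _ => by ring
  have h1 := hb.1 (hv.trans (map_zero _).symm)
  funext i
  exact congrArg (fun v : Coord n => v i) h1

lemma upper_eq (i j : Fin n) (u : Coord n) : g.upper e i j u = (g.gram e u)⁻¹ i j := rfl

lemma upper_symm (i j : Fin n) (u : Coord n) : g.upper e i j u = g.upper e j i u := by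
  rw [upper_eq, upper_eq, ← Matrix.transpose_apply (g.gram e u)⁻¹, Matrix.transpose_nonsing_inv,
    gram_transpose]

lemma sum_upper_mul_lower [IsManifold (𝓡 n) ∞ M] (he : e ∈ charts n M) {u : Coord n}
    (hu : u ∈ e.target) (i j : Fin n) :
    ∑ p, g.upper e i p u * g.lower e p j u = if i = j then 1 else 0 := by
  have := congrFun (congrFun (Matrix.nonsing_inv_mul _ (g.isUnit_det_gram he hu)) i) j
  rwa [Matrix.mul_apply, Matrix.one_apply] at this

lemma contDiffOn_lower (he : e ∈ charts n M) (i j : Fin n) :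
    ContDiffOn ℝ ∞ (g.lower e i j) e.target := g.smooth e he i j

lemma contDiffOn_det {U : Set (Coord n)} {X : Coord n → Matrix (Fin n) (Fin n) ℝ}
    (hX : MatSmoothOn X U) : ContDiffOn ℝ ∞ (fun v => (X v).det) U := by
  simp only [Matrix.det_apply]
  refine ContDiffOn.sum fun σ _ => ContDiffOn.const_smul _ ?_
  exact contDiffOn_prod fun i _ => hX _ _

lemma contDiffOn_upper [IsManifold (𝓡 n) ∞ M] (he : e ∈ charts n M) (i j : Fin n) :
    ContDiffOn ℝ ∞ (g.upper e i j) e.target := by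
  have hg : MatSmoothOn (g.gram e) e.target := g.contDiffOn_lower he
  have hadj : ContDiffOn ℝ ∞ (fun v => (g.gram e v).adjugate i j) e.target := by
    simp only [Matrix.adjugate_apply]
    refine contDiffOn_det fun a b => ?_
    by_cases h : a = j
    · subst h; simp only [Matrix.updateRow_self]; exact contDiffOn_const
    · simp only [Matrix.updateRow_ne h]; exact hg a b
  have : ContDiffOn ℝ ∞ (fun v => ((g.gram e v).det)⁻¹ * (g.gram e v).adjugate i j) e.target :=
    ((contDiffOn_det hg).inv fun v hv => (g.isUnit_det_gram he hv).ne_zero).mul hadj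
  refine this.congr fun v _ => ?_
  simp [upper_eq, Matrix.inv_def]

end PseudoRiemannianMetric

namespace PseudoRiemannianMetric

variable {n : ℕ} {M : Type*} [TopologicalSpace M] [ChartedSpace (Coord n) M]
  (g : PseudoRiemannianMetric n M) {e : OpenPartialHomeomorph M (Coord n)}

variable (e) in
/-- The connection matrices `(l, m) ↦ Γ^m_{jl}`. -/
def connMat (j : Fin n) (u : Coord n) : Matrix (Fin n) (Fin n) ℝ :=
  Matrix.of fun l m => g.christoffel e m j l u

variable (e) in
/-- The curvature matrices `(l, m) ↦ R_{jkl}{}^m`. -/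
def curvMat (j k : Fin n) (u : Coord n) : Matrix (Fin n) (Fin n) ℝ :=
  Matrix.of fun l m => g.riemannMixed e j k l m u

lemma christoffel_symm (k i j : Fin n) (u : Coord n) :
    g.christoffel e k i j u = g.christoffel e k j i u := by
  unfold christoffel
  rw [show g.lower e i j = g.lower e j i from funext (g.lower_symm i j)]
  congr 1
  exact Finset.sum_congr rfl fun p _ => by ring

lemma riemannMixed_antisymm (j k l m : Fin n) (u : Coord n) :
    g.riemannMixed e j k l m u = -g.riemannMixed e k j l m u := by
  unfold riemannMixed
  rw [Finset.sum_sub_distrib, Finset.sum_sub_distrib]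
  ring

lemma riemannMixed_cyclic (j k l m : Fin n) (u : Coord n) :
    g.riemannMixed e j k l m u + g.riemannMixed e k l j m u + g.riemannMixed e l j k m u = 0 := by
  unfold riemannMixed
  simp only [Finset.sum_sub_distrib]
  have h := fun a b c => funext (g.christoffel_symm (e := e) a b c)
  rw [h m j l, h m k l, h m k j]
  simp only [funext_iff] at h
  simp only [h _ j l, h _ k l, h _ k j]
  ring

lemma curvMat_eq (j k : Fin n) (u : Coord n) :
    g.curvMat e j k u = matPd k (g.connMat e j) u - matPd j (g.connMat e k) u
      + (g.connMat e j u * g.connMat e k u - g.connMat e k u * g.connMat e j u) := by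
  ext l m
  simp only [curvMat, riemannMixed, Matrix.of_apply, Matrix.add_apply, Matrix.sub_apply, matPd,
    Matrix.mul_apply, connMat, Finset.sum_sub_distrib]
  simp only [g.christoffel_symm _ _ k, g.christoffel_symm _ _ j]

lemma riemann_eq (j k l m : Fin n) (u : Coord n) :
    g.riemann e j k l m u = (g.curvMat e j k u * g.gram e u) l m := rfl

lemma matSmoothOn_gram (he : e ∈ charts n M) : MatSmoothOn (g.gram e) e.target :=
  g.contDiffOn_lower he

lemma riemann_antisymm_left (j k l m : Fin n) (u : Coord n) :
    g.riemann e j k l m u = -g.riemann e k j l m u := by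
  simp only [riemann, g.riemannMixed_antisymm j k, neg_mul, Finset.sum_neg_distrib]

lemma riemann_cyclic (j k l m : Fin n) (u : Coord n) :
    g.riemann e j k l m u + g.riemann e k l j m u + g.riemann e l j k m u = 0 := by
  simp only [riemann, ← Finset.sum_add_distrib]
  exact Finset.sum_eq_zero fun p _ => by
    rw [← add_mul, ← add_mul, riemannMixed_cyclic, zero_mul]

variable [IsManifold (𝓡 n) ∞ M]

lemma contDiffOn_christoffel (he : e ∈ charts n M) (k i j : Fin n) :
    ContDiffOn ℝ ∞ (g.christoffel e k i j) e.target := by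
  refine contDiffOn_const.mul (ContDiffOn.sum fun p _ => (g.contDiffOn_upper he k p).mul ?_)
  have h := fun i j k => contDiffOn_pd e.open_target i (g.contDiffOn_lower he j k)
  exact ((h _ _ _).add (h _ _ _)).sub (h _ _ _)

lemma matSmoothOn_connMat (he : e ∈ charts n M) (j : Fin n) :
    MatSmoothOn (g.connMat e j) e.target :=
  fun l m => g.contDiffOn_christoffel he m j l

lemma contDiffOn_riemannMixed (he : e ∈ charts n M) (j k l m : Fin n) :
    ContDiffOn ℝ ∞ (g.riemannMixed e j k l m) e.target := by
  have h := fun k i j => g.contDiffOn_christoffel he k i j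
  exact ((contDiffOn_pd e.open_target _ (h _ _ _)).sub
    (contDiffOn_pd e.open_target _ (h _ _ _))).add
    (ContDiffOn.sum fun p _ => ((h _ _ _).mul (h _ _ _)).sub ((h _ _ _).mul (h _ _ _)))

lemma matSmoothOn_curvMat (he : e ∈ charts n M) (j k : Fin n) :
    MatSmoothOn (g.curvMat e j k) e.target :=
  fun l m => g.contDiffOn_riemannMixed he j k l m

lemma contDiffOn_riemann (he : e ∈ charts n M) (j k l m : Fin n) :
    ContDiffOn ℝ ∞ (g.riemann e j k l m) e.target :=
  ContDiffOn.sum fun p _ => (g.contDiffOn_riemannMixed he j k l p).mul (g.contDiffOn_lower he p m)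

lemma contDiffOn_scalar (he : e ∈ charts n M) : ContDiffOn ℝ ∞ (g.scalar e) e.target :=
  ContDiffOn.sum fun k _ => ContDiffOn.sum fun l _ => (g.contDiffOn_upper he k l).mul
    (ContDiffOn.sum fun m _ => g.contDiffOn_riemannMixed he k m l m)

section Pointwise

variable (he : e ∈ charts n M) {u : Coord n} (hu : u ∈ e.target)
include he hu

lemma connMat_mul_gram (i l m : Fin n) :
    (g.connMat e i u * g.gram e u) l m =
      1 / 2 * (pd i (g.lower e m l) u + pd l (g.lower e m i) u - pd m (g.lower e i l) u) := by
  simp only [Matrix.mul_apply, connMat, gram, Matrix.of_apply, christoffel]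
  simp only [mul_assoc, ← Finset.mul_sum, Finset.sum_mul]
  congr 1
  rw [Finset.sum_comm]
  have : ∀ q : Fin n, ∑ p, g.upper e p q u *
      ((pd i (g.lower e q l) u + pd l (g.lower e q i) u - pd q (g.lower e i l) u)
        * g.lower e p m u) =
      (pd i (g.lower e q l) u + pd l (g.lower e q i) u - pd q (g.lower e i l) u)
        * if q = m then 1 else 0 := by
    intro q
    rw [← g.sum_upper_mul_lower he hu q m, Finset.mul_sum]
    exact Finset.sum_congr rfl fun p _ => by rw [g.upper_symm p q]; ring
  simp only [this]
  simp

lemma matPd_gram (i : Fin n) :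
    matPd i (g.gram e) u
      = g.connMat e i u * g.gram e u + (g.connMat e i u * g.gram e u).transpose := by
  ext l m
  rw [Matrix.add_apply, Matrix.transpose_apply, g.connMat_mul_gram he hu,
    g.connMat_mul_gram he hu]
  have h := fun a b => funext (g.lower_symm (e := e) a b)
  rw [h m l, h i l, h i m]
  change pd i (g.lower e l m) u = _
  ring

lemma matPd_gram' (i : Fin n) :
    matPd i (g.gram e) u
      = g.connMat e i u * g.gram e u + g.gram e u * (g.connMat e i u).transpose := by
  rw [g.matPd_gram he hu, Matrix.transpose_mul, g.gram_transpose]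

lemma pd_lower (i l m : Fin n) :
    pd i (g.lower e l m) u = ∑ p, (g.christoffel e p i l u * g.lower e p m u
      + g.christoffel e p i m u * g.lower e l p u) := by
  have := congrFun (congrFun (g.matPd_gram' he hu i) l) m
  simp only [Matrix.add_apply, Matrix.mul_apply, Matrix.transpose_apply, connMat, gram,
    Matrix.of_apply, ← Finset.sum_add_distrib] at this
  refine this.trans (Finset.sum_congr rfl fun p _ => by ring)

/-- Antisymmetry of the lowered curvature in the last pair of indices. -/
lemma riemann_antisymm_right (j k l m : Fin n) :
    g.riemann e j k l m u = -g.riemann e j k m l u := by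
  have hU := e.open_target
  have hg := g.matSmoothOn_gram he
  have hΓ := g.matSmoothOn_connMat he
  have hL : ∀ i, MatSmoothOn (fun v => g.connMat e i v * g.gram e v) e.target :=
    fun i => (hΓ i).mul hg
  have hR : ∀ j k, g.curvMat e j k u * g.gram e u
      = matPd k (fun v => g.connMat e j v * g.gram e v) u
        - matPd j (fun v => g.connMat e k v * g.gram e v) u
        - g.connMat e j u * g.gram e u * (g.connMat e k u).transpose
        + g.connMat e k u * g.gram e u * (g.connMat e j u).transpose := by
    intro j k
    rw [matPd_mul hU hu _ (hΓ _) hg, matPd_mul hU hu _ (hΓ _) hg, g.matPd_gram' he hu,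
      g.matPd_gram' he hu, curvMat_eq]
    noncomm_ring
  have hd : ∀ j k, matPd k (matPd j (g.gram e)) u
      = matPd k (fun v => g.connMat e j v * g.gram e v) u
        + (matPd k (fun v => g.connMat e j v * g.gram e v) u).transpose := by
    intro j k
    rw [← matPd_transpose, ← matPd_add hU hu _ (hL j) (hL j).transpose]
    exact matPd_congr hU hu k fun v hv => g.matPd_gram he hv j
  have hsymm : g.curvMat e j k u * g.gram e u + (g.curvMat e j k u * g.gram e u).transpose = 0 := by
    have h1 := matPd_comm hU hu j k hg
    rw [hd, hd] at h1
    rw [hR]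
    simp only [Matrix.transpose_add, Matrix.transpose_sub, Matrix.transpose_mul,
      Matrix.transpose_transpose, g.gram_transpose, ← Matrix.mul_assoc]
    generalize matPd k (fun v => g.connMat e j v * g.gram e v) u = P at *
    generalize matPd j (fun v => g.connMat e k v * g.gram e v) u = Q at *
    rw [← sub_eq_zero] at h1
    rw [← neg_eq_zero, ← h1]
    noncomm_ring
  have := congrFun (congrFun hsymm l) m
  rw [Matrix.add_apply, Matrix.transpose_apply, Matrix.zero_apply] at this
  rw [riemann_eq, riemann_eq]
  linarith

lemma riemann_pair_symm (j k l m : Fin n) :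
    g.riemann e j k l m u = g.riemann e l m j k u := by
  have c := fun j k l m => g.riemann_cyclic (e := e) j k l m u
  have a := fun j k l m => g.riemann_antisymm_left (e := e) j k l m u
  have b := fun j k l m => g.riemann_antisymm_right he hu j k l m
  linarith [c j k l m, c k l m j, c l m j k, c m j k l, a j k l m, a j k m l, a k l m j, a l m j k,
    a k l j m, a j l k m, a l j k m, a m j k l, a j m k l, a m k j l, a k m j l, a m l k j,
    b j k l m, b k l j m, b l j k m, b k l m j, b l m k j, b l m j k, b m k l j, b k m l j,
    b m j l k, b m j k l, b j l m k, b l j m k, b j k m l]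

/-- The derivative of the lowered curvature through the mixed one. -/
lemma covRiemann_eq (i j k l m : Fin n) :
    g.covRiemann e i j k l m u =
      ((matPd i (g.curvMat e j k) u - g.connMat e i u * g.curvMat e j k u
        + g.curvMat e j k u * g.connMat e i u) * g.gram e u) l m
      - ∑ p, g.christoffel e p i j u * g.riemann e p k l m u
      - ∑ p, g.christoffel e p i k u * g.riemann e j p l m u := by
  have h1 : pd i (g.riemann e j k l m) u
      = matPd i (fun v => g.curvMat e j k v * g.gram e v) u l m := rfl
  have h2 : ∑ p, g.christoffel e p i l u * g.riemann e j k p m u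
      = (g.connMat e i u * (g.curvMat e j k u * g.gram e u)) l m := rfl
  have h3 : ∑ p, g.christoffel e p i m u * g.riemann e j k l p u
      = ((g.curvMat e j k u * g.gram e u) * (g.connMat e i u).transpose) l m := by
    rw [Matrix.mul_apply]
    exact Finset.sum_congr rfl fun p _ => mul_comm _ _
  rw [covRiemann, h1, matPd_mul e.open_target hu i (g.matSmoothOn_curvMat he j k)
    (g.matSmoothOn_gram he), g.matPd_gram' he hu]
  simp only [Finset.sum_add_distrib]
  rw [h2, h3]
  simp only [Matrix.add_mul, Matrix.sub_mul, Matrix.mul_add, ← Matrix.mul_assoc, Matrix.add_apply,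
    Matrix.sub_apply]
  ring

/-- The second Bianchi identity. -/
lemma covRiemann_cyclic (i j k l m : Fin n) :
    g.covRiemann e i j k l m u + g.covRiemann e j k i l m u + g.covRiemann e k i j l m u = 0 := by
  have hU := e.open_target
  have hΓ := g.matSmoothOn_connMat he
  have hdΓ := fun i j => (hΓ j).matPd hU i
  have hΓΓ := fun i j => (hΓ i).mul (hΓ j)
  have hdR : ∀ i j k, matPd i (g.curvMat e j k) u
      = matPd i (matPd k (g.connMat e j)) u - matPd i (matPd j (g.connMat e k)) u
        + (matPd i (g.connMat e j) u * g.connMat e k u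
          + g.connMat e j u * matPd i (g.connMat e k) u
          - (matPd i (g.connMat e k) u * g.connMat e j u
          + g.connMat e k u * matPd i (g.connMat e j) u)) := by
    intro i j k
    rw [← matPd_mul hU hu i (hΓ j) (hΓ k), ← matPd_mul hU hu i (hΓ k) (hΓ j),
      ← matPd_sub hU hu i (hΓΓ _ _) (hΓΓ _ _), ← matPd_sub hU hu i (hdΓ _ _) (hdΓ _ _),
      ← matPd_add hU hu i ((hdΓ _ _).sub (hdΓ _ _)) ((hΓΓ _ _).sub (hΓΓ _ _))]
    exact matPd_congr hU hu i fun v _ => g.curvMat_eq j k v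
  have key : (matPd i (g.curvMat e j k) u - g.connMat e i u * g.curvMat e j k u
        + g.curvMat e j k u * g.connMat e i u)
      + (matPd j (g.curvMat e k i) u - g.connMat e j u * g.curvMat e k i u
        + g.curvMat e k i u * g.connMat e j u)
      + (matPd k (g.curvMat e i j) u - g.connMat e k u * g.curvMat e i j u
        + g.curvMat e i j u * g.connMat e k u) = 0 := by
    rw [hdR, hdR, hdR, matPd_comm hU hu j i (hΓ k), matPd_comm hU hu k i (hΓ j),
      matPd_comm hU hu k j (hΓ i)]
    simp only [curvMat_eq]
    noncomm_ring
  have hc : ∀ a b c, ∑ p, g.christoffel e p a b u * g.riemann e p c l m u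
      + ∑ p, g.christoffel e p b a u * g.riemann e c p l m u = 0 := by
    intro a b c
    rw [← Finset.sum_add_distrib]
    refine Finset.sum_eq_zero fun p _ => ?_
    rw [g.christoffel_symm p b a, g.riemann_antisymm_left c p]
    ring
  rw [g.covRiemann_eq he hu, g.covRiemann_eq he hu, g.covRiemann_eq he hu]
  generalize matPd i (g.curvMat e j k) u - g.connMat e i u * g.curvMat e j k u
        + g.curvMat e j k u * g.connMat e i u = P at *
  generalize matPd j (g.curvMat e k i) u - g.connMat e j u * g.curvMat e k i u
        + g.curvMat e k i u * g.connMat e j u = Q at *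
  generalize matPd k (g.curvMat e i j) u - g.connMat e k u * g.curvMat e i j u
        + g.curvMat e i j u * g.connMat e k u = S at *
  have key' : ((P + Q + S) * g.gram e u) l m = 0 := by rw [key, Matrix.zero_mul, Matrix.zero_apply]
  simp only [Matrix.add_mul, Matrix.add_apply] at key'
  linarith [hc i j k, hc j k i, hc k i j]

end Pointwise

end PseudoRiemannianMetric

section CurvatureAlgebra

variable {V : Type*} [AddCommGroup V] [Module ℝ V]

/-- On a space of dimension at least three, bilinear forms `H`, `D` with
`H(w,x) D(y,z) - H(w,y) D(x,z) = κ (g(w,y) g(x,z) - g(w,x) g(y,z))`, `κ ≠ 0`,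
have `D` proportional to the metric. -/
lemma exists_eq_smul_metric [FiniteDimensional ℝ V] (hV : 3 ≤ Module.finrank ℝ V)
    (g H D : V →ₗ[ℝ] V →ₗ[ℝ] ℝ)
    (hg : ∀ v, (∀ w, g w v = 0) → v = 0) (hsymm : ∀ v w, g v w = g w v) {κ : ℝ} (hκ : κ ≠ 0)
    (hD : ∀ x z, D x z = D z x)
    (h : ∀ w x y z, H w x * D y z - H w y * D x z = κ * (g w y * g x z - g w x * g y z)) :
    ∃ c : ℝ, ∀ x z, D x z = c * g x z := by
  have step : ∀ z, z ≠ 0 → ∃ c : ℝ, ∀ x, D x z = c * g x z := by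
    intro z hz
    let L : V →ₗ[ℝ] ℝ × ℝ := (D.flip z).prod (g.flip z)
    have hL : LinearMap.ker L ≠ ⊥ := by
      apply LinearMap.ker_ne_bot_of_finrank_lt
      simp; omega
    obtain ⟨v, hv, hv0⟩ := (Submodule.ne_bot_iff _).mp hL
    have hv1 : D v z = 0 := congrArg Prod.fst (LinearMap.mem_ker.mp hv)
    have hv2 : g v z = 0 := congrArg Prod.snd (LinearMap.mem_ker.mp hv)
    obtain ⟨w, hw⟩ : ∃ w, g w v ≠ 0 := by
      by_contra! hcon; exact hv0 (hg v hcon)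
    have key : ∀ x, H w v * D x z = -κ * g w v * g x z := by
      intro x
      have := h w x v z
      rw [hv1, hv2] at this
      linarith
    have hHv : H w v ≠ 0 := by
      intro h0
      apply hz
      apply hg
      intro x
      have := key x
      rw [h0, zero_mul] at this
      simpa [hκ, hw] using this.symm
    refine ⟨-κ * g w v / H w v, fun x => ?_⟩
    have := key x
    field_simp
    linarith
  obtain ⟨z₀, hz₀⟩ : ∃ z : V, z ≠ 0 := by
    have : Nontrivial V := Module.nontrivial_of_finrank_pos (R := ℝ) (by omega)
    exact exists_ne 0
  obtain ⟨c, hc⟩ := step z₀ hz₀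
  obtain ⟨y₀, hy₀⟩ : ∃ y, g y z₀ ≠ 0 := by
    by_contra! hcon; exact hz₀ (hg z₀ hcon)
  have good : ∀ z, g z z₀ ≠ 0 → ∀ x, D x z = c * g x z := by
    intro z hz
    have hz0 : z ≠ 0 := by rintro rfl; simp at hz
    obtain ⟨c', hc'⟩ := step z hz0
    have e1 := hc z
    have e2 := hc' z₀
    rw [hD, e1, hsymm z₀ z] at e2
    have : c' = c := (mul_right_cancel₀ hz e2).symm
    exact this ▸ hc'
  refine ⟨c, fun x z => ?_⟩
  by_cases hz : g z z₀ = 0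
  · have e1 := good (z + y₀) (by simpa [hz] using hy₀) x
    have e2 := good y₀ hy₀ x
    rw [map_add, map_add] at e1
    linarith
  · exact good z hz x

/-- A curvature-like tensor `T` with `α ∧ T = 0`, whose first-order prolongation holds with a
coefficient `b ≠ 0`, is of quasi-constant type with direction `α`. -/
lemma exists_quasiConstant [FiniteDimensional ℝ V] (hV : 4 ≤ Module.finrank ℝ V)
    (g H : V →ₗ[ℝ] V →ₗ[ℝ] ℝ) (α ζ : V →ₗ[ℝ] ℝ) (T : V →ₗ[ℝ] V →ₗ[ℝ] V →ₗ[ℝ] V →ₗ[ℝ] ℝ)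
    (a : V) {b : ℝ} (hb : b ≠ 0) (ha : ∀ v, g a v = α v) (hs : α a ≠ 0)
    (hg : ∀ v, (∀ w, g w v = 0) → v = 0) (hsymm : ∀ v w, g v w = g w v)
    (hT₁ : ∀ x y z w, T x y z w = -T y x z w)
    (hT₂ : ∀ x y z w, T x y z w = T z w x y)
    (hα : ∀ v x y z w, α v * T x y z w + α x * T y v z w + α y * T v x z w = 0)
    (hH : ∀ q v x y z w, H q v * T x y z w + H q x * T y v z w + H q y * T v x z w
      + α v * ((b * α q - ζ q) * (g w x * g y z - g w y * g x z)
        + b / 2 * (α z * (g w x * g y q - g w y * g x q) + α w * (g q x * g y z - g q y * g x z)))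
      + α x * ((b * α q - ζ q) * (g w y * g v z - g w v * g y z)
        + b / 2 * (α z * (g w y * g v q - g w v * g y q) + α w * (g q y * g v z - g q v * g y z)))
      + α y * ((b * α q - ζ q) * (g w v * g x z - g w x * g v z)
        + b / 2 * (α z * (g w v * g x q - g w x * g v q) + α w * (g q v * g x z - g q x * g v z)))
      = 0) :
    ∃ c : ℝ, ∀ x y z w, T x y z w = c * (α x * α z * g y w - α x * α w * g y z
      - α y * α z * g x w + α y * α w * g x z) := by
  set K := LinearMap.ker α with hK
  have hKmem : ∀ x : K, α x = 0 := fun x => x.2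
  have hKdim : 3 ≤ Module.finrank ℝ K := by
    have h1 := LinearMap.finrank_range_add_finrank_ker α
    have h2 : Module.finrank ℝ (LinearMap.range α) ≤ 1 := by
      simpa using Submodule.finrank_le (LinearMap.range α)
    rw [← hK] at h1
    omega
  let proj : V → V := fun x => x - (α x / α a) • a
  have hproj : ∀ x, proj x ∈ K := by
    intro x
    simp only [proj, hK, LinearMap.mem_ker, map_sub, map_smul, smul_eq_mul]
    field_simp
    ring
  have ha' : ∀ v, g v a = α v := fun v => by rw [hsymm, ha]
  let D : V →ₗ[ℝ] V →ₗ[ℝ] ℝ := ((T.flip a).compr₂ (LinearMap.applyₗ a))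
  have hDdef : ∀ x z, D x z = T x a z a := fun x z => rfl
  have hDsymm : ∀ x z, D x z = D z x := fun x z => by rw [hDdef, hDdef, hT₂]
  have hDa : ∀ x, D a x = 0 := fun x => by
    rw [hDdef]; linarith [hT₁ a a x a]
  have hTK : ∀ x y : K, ∀ z w, T x y z w = 0 := by
    intro x y z w
    have := hα a x y z w
    rw [hKmem, hKmem] at this
    simpa [hs] using this
  obtain ⟨c, hc⟩ := exists_eq_smul_metric (V := K) hKdim (g.domRestrict₁₂ K K)
    (H.domRestrict₁₂ K K) (D.domRestrict₁₂ K K) (κ := b / 2 * α a ^ 2)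
    (by
      intro v hv
      have : (v : V) = 0 := by
        apply hg
        intro w
        have h0 := hv ⟨proj w, hproj w⟩
        rw [LinearMap.domRestrict₁₂_apply] at h0
        simpa [proj, ha, hKmem] using h0
      exact Subtype.ext this)
    (fun v w => hsymm v w) (by positivity) (fun x z => hDsymm x z)
    (by
      intro w x y z
      simp only [LinearMap.domRestrict₁₂_apply, hDdef]
      have e := hH w a x y z a
      have e1 := hT₁ a x z a
      simp only [hTK, hKmem, ha, ha', e1] at e
      rw [hsymm y w, hsymm x w] at e
      linear_combination e)
  have hD : ∀ x z, D x z = c * (g x z - α x * α z / α a) := by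
    intro x z
    have := hc ⟨proj x, hproj x⟩ ⟨proj z, hproj z⟩
    simp only [LinearMap.domRestrict₁₂_apply, proj, map_sub, map_smul, LinearMap.sub_apply,
      LinearMap.smul_apply, hDa, hDsymm _ a, ha, ha', smul_eq_mul] at this
    rw [show D x z = c * (g x z - α z / α a * α x - (α x / α a * (α z - α z / α a * α a))) by
      linarith]
    field_simp
    ring
  have h1 : ∀ x y z w, α a * T x y z w = α x * T a y z w - α y * T a x z w := by
    intro x y z w
    have := hα a x y z w
    rw [hT₁ y a] at this
    linarith
  refine ⟨c / α a ^ 2, fun x y z w => ?_⟩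
  have haD : ∀ x y, T a x a y = D x y := by
    intro x y
    rw [hT₁, hT₂, hT₁, neg_neg, hDsymm, hDdef]
  have h2 : ∀ y z w, α a * T a y z w = α z * D w y - α w * D z y := by
    intro y z w
    rw [hT₂, h1, haD, haD]
  have h3 : α a ^ 2 * T x y z w = α x * (α z * D w y - α w * D z y)
      - α y * (α z * D w x - α w * D z x) := by
    rw [← h2, ← h2]
    linear_combination α a * h1 x y z w
  simp only [hD] at h3
  rw [hsymm w y, hsymm z y, hsymm w x, hsymm z x] at h3
  field_simp at h3 ⊢
  apply mul_left_cancel₀ hs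
  linear_combination h3

end CurvatureAlgebra

namespace PseudoRiemannianMetric

variable {n : ℕ} {M : Type*} [TopologicalSpace M] [ChartedSpace (Coord n) M]
  (g : PseudoRiemannianMetric n M) {e : OpenPartialHomeomorph M (Coord n)}

variable (e) in
/-- The covariant derivative `∇_i A_j` of a one-form. -/
def covOneForm (A : OneForm n M) (i j : Fin n) (u : Coord n) : ℝ :=
  pd i (A.comp e j) u - ∑ p, g.christoffel e p i j u * A.comp e p u

variable (e) in
/-- The modified curvature `R_{jklm} - ψ G_{jklm}`. -/
def reducedCurv (ψ : M → ℝ) (j k l m : Fin n) (u : Coord n) : ℝ :=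
  g.riemann e j k l m u - ψ (e.symm u) * g.G e j k l m u

variable {A : OneForm n M} {β ψ : M → ℝ}

lemma pd_riemann (h j k l m : Fin n) :
    pd h (g.riemann e j k l m) u = g.covRiemann e h j k l m u
      + ∑ p, (g.christoffel e p h j u * g.riemann e p k l m u
      + g.christoffel e p h k u * g.riemann e j p l m u
      + g.christoffel e p h l u * g.riemann e j k p m u
      + g.christoffel e p h m u * g.riemann e j k l p u) := by
  rw [covRiemann]; ring

lemma contDiffOn_G (he : e ∈ charts n M) (j k l m : Fin n) : ContDiffOn ℝ ∞ (g.G e j k l m) e.target :=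
  have h := fun a b => g.contDiffOn_lower he a b
  ((h _ _).mul (h _ _)).sub ((h _ _).mul (h _ _))

lemma reducedCurv_antisymm (j k l m : Fin n) (u : Coord n) :
    g.reducedCurv e ψ j k l m u = -g.reducedCurv e ψ k j l m u := by
  unfold reducedCurv G
  rw [riemann_antisymm_left]
  ring

variable [IsManifold (𝓡 n) ∞ M] (he : e ∈ charts n M) {u : Coord n} (hu : u ∈ e.target)
include he hu

lemma reducedCurv_pair_symm (j k l m : Fin n) :
    g.reducedCurv e ψ j k l m u = g.reducedCurv e ψ l m j k u := by
  unfold reducedCurv G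
  rw [g.riemann_pair_symm he hu, g.lower_symm k l, g.lower_symm m j, g.lower_symm m k,
    g.lower_symm j l]
  ring

/-- The tensor `G` is parallel. -/
lemma pd_G (h j k l m : Fin n) :
    pd h (g.G e j k l m) u = ∑ p, (g.christoffel e p h j u * g.G e p k l m u
      + g.christoffel e p h k u * g.G e j p l m u + g.christoffel e p h l u * g.G e j k p m u
      + g.christoffel e p h m u * g.G e j k l p u) := by
  have hd := fun a b =>
    differentiableAt_of_contDiffOn e.open_target (g.contDiffOn_lower he a b) hu
  change pd h (fun v => g.lower e m j v * g.lower e k l v - g.lower e m k v * g.lower e j l v) u = _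
  rw [pd_sub h ((hd _ _).fun_mul (hd _ _)) ((hd _ _).fun_mul (hd _ _)), pd_mul h (hd _ _) (hd _ _),
    pd_mul h (hd _ _) (hd _ _)]
  simp only [g.pd_lower he hu, Finset.sum_mul, Finset.mul_sum, ← Finset.sum_add_distrib,
    ← Finset.sum_sub_distrib, G]
  exact Finset.sum_congr rfl fun p _ => by ring

lemma pd_reducedCurv (hψ : ContMDiff (𝓡 n) 𝓘(ℝ) ∞ ψ) (h j k l m : Fin n) :
    pd h (g.reducedCurv e ψ j k l m) u = g.covRiemann e h j k l m u
      - pd h (fun v => ψ (e.symm v)) u * g.G e j k l m u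
      + ∑ p, (g.christoffel e p h j u * g.reducedCurv e ψ p k l m u
      + g.christoffel e p h k u * g.reducedCurv e ψ j p l m u
      + g.christoffel e p h l u * g.reducedCurv e ψ j k p m u
      + g.christoffel e p h m u * g.reducedCurv e ψ j k l p u) := by
  have hU := e.open_target
  have d1 := differentiableAt_of_contDiffOn hU (g.contDiffOn_riemann he j k l m) hu
  have d2 := differentiableAt_of_contDiffOn hU (contDiffOn_comp_chart_symm he hψ) hu
  have d3 := differentiableAt_of_contDiffOn hU (g.contDiffOn_G he j k l m) hu
  change pd h (fun v => g.riemann e j k l m v - ψ (e.symm v) * g.G e j k l m v) u = _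
  rw [pd_sub h d1 (d2.fun_mul d3), pd_mul h d2 d3, g.pd_riemann, g.pd_G he hu, add_sub_assoc,
    sub_add_eq_sub_sub_swap, Finset.mul_sum, ← Finset.sum_sub_distrib,
    sub_eq_add_neg (Finset.sum _ _), ← add_assoc, ← sub_eq_add_neg]
  rw [add_sub_right_comm]
  congr 1
  exact Finset.sum_congr rfl fun p _ => by simp only [reducedCurv]; ring

/-- The second Bianchi identity of an extended recurrent metric: `A ∧ (R - ψ G) = 0`. -/
lemma IsExtendedRecurrent.wedge_eq_zero (H : g.IsExtendedRecurrent A β ψ) (i j k l m : Fin n) :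
    A.comp e i u * g.reducedCurv e ψ j k l m u + A.comp e j u * g.reducedCurv e ψ k i l m u
      + A.comp e k u * g.reducedCurv e ψ i j l m u = 0 := by
  have hB := g.covRiemann_cyclic he hu i j k l m
  rw [H.recurrence e he u hu, H.recurrence e he u hu, H.recurrence e he u hu] at hB
  simp only [reducedCurv, G] at hB ⊢
  rw [g.lower_symm j i, g.lower_symm k i, g.lower_symm k j] at hB
  linear_combination hB

/-- First prolongation of `A ∧ (R - ψ G) = 0`. -/
lemma IsExtendedRecurrent.prolongation (H : g.IsExtendedRecurrent A β ψ) (h i j k l m : Fin n) :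
    g.covOneForm e A h i u * g.reducedCurv e ψ j k l m u
      + g.covOneForm e A h j u * g.reducedCurv e ψ k i l m u
      + g.covOneForm e A h k u * g.reducedCurv e ψ i j l m u
      + A.comp e i u * (g.covRiemann e h j k l m u
        - pd h (fun v => ψ (e.symm v)) u * g.G e j k l m u)
      + A.comp e j u * (g.covRiemann e h k i l m u
        - pd h (fun v => ψ (e.symm v)) u * g.G e k i l m u)
      + A.comp e k u * (g.covRiemann e h i j l m u
        - pd h (fun v => ψ (e.symm v)) u * g.G e i j l m u) = 0 := by
  have hU := e.open_target
  have dA : ∀ i, DifferentiableAt ℝ (A.comp e i) u :=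
    fun i => differentiableAt_of_contDiffOn hU (A.smooth e he i) hu
  have dT : ∀ j k l m, DifferentiableAt ℝ (g.reducedCurv e ψ j k l m) u := fun j k l m =>
    differentiableAt_of_contDiffOn hU ((g.contDiffOn_riemann he j k l m).sub
      ((contDiffOn_comp_chart_symm he H.smooth_ψ).mul (g.contDiffOn_G he j k l m))) hu
  have hpd : pd h (fun v => A.comp e i v * g.reducedCurv e ψ j k l m v
      + A.comp e j v * g.reducedCurv e ψ k i l m v
      + A.comp e k v * g.reducedCurv e ψ i j l m v) u = 0 := by
    rw [pd_congr hU hu h fun v hv => H.wedge_eq_zero g he hv i j k l m, pd_const]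
  have dAT : ∀ i j k l m, DifferentiableAt ℝ
      (fun v => A.comp e i v * g.reducedCurv e ψ j k l m v) u :=
    fun i j k l m => (dA i).fun_mul (dT j k l m)
  rw [pd_add h ((dAT _ _ _ _ _).fun_add (dAT _ _ _ _ _)) (dAT _ _ _ _ _),
    pd_add h (dAT _ _ _ _ _) (dAT _ _ _ _ _), pd_mul h (dA _) (dT _ _ _ _),
    pd_mul h (dA _) (dT _ _ _ _), pd_mul h (dA _) (dT _ _ _ _),
    g.pd_reducedCurv he hu H.smooth_ψ, g.pd_reducedCurv he hu H.smooth_ψ,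
    g.pd_reducedCurv he hu H.smooth_ψ] at hpd
  have hW := fun i j k l m => H.wedge_eq_zero g he hu i j k l m
  have hΓ : ∑ p, ((g.christoffel e p h i u * A.comp e p u) * g.reducedCurv e ψ j k l m u
      + (g.christoffel e p h j u * A.comp e p u) * g.reducedCurv e ψ k i l m u
      + (g.christoffel e p h k u * A.comp e p u) * g.reducedCurv e ψ i j l m u
      + A.comp e i u * (g.christoffel e p h j u * g.reducedCurv e ψ p k l m u
      + g.christoffel e p h k u * g.reducedCurv e ψ j p l m u
      + g.christoffel e p h l u * g.reducedCurv e ψ j k p m u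
      + g.christoffel e p h m u * g.reducedCurv e ψ j k l p u)
      + A.comp e j u * (g.christoffel e p h k u * g.reducedCurv e ψ p i l m u
      + g.christoffel e p h i u * g.reducedCurv e ψ k p l m u
      + g.christoffel e p h l u * g.reducedCurv e ψ k i p m u
      + g.christoffel e p h m u * g.reducedCurv e ψ k i l p u)
      + A.comp e k u * (g.christoffel e p h i u * g.reducedCurv e ψ p j l m u
      + g.christoffel e p h j u * g.reducedCurv e ψ i p l m u
      + g.christoffel e p h l u * g.reducedCurv e ψ i j p m u
      + g.christoffel e p h m u * g.reducedCurv e ψ i j l p u)) = 0 :=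
    Finset.sum_eq_zero fun p _ => by
      linear_combination g.christoffel e p h i u * hW p j k l m
        + g.christoffel e p h j u * hW i p k l m + g.christoffel e p h k u * hW i j p l m
        + g.christoffel e p h l u * hW i j k p m + g.christoffel e p h m u * hW i j k l p
  rw [Finset.sum_add_distrib, Finset.sum_add_distrib, Finset.sum_add_distrib,
    Finset.sum_add_distrib, Finset.sum_add_distrib, ← Finset.sum_mul, ← Finset.sum_mul,
    ← Finset.sum_mul, ← Finset.mul_sum, ← Finset.mul_sum, ← Finset.mul_sum] at hΓ
  simp only [covOneForm]
  linear_combination hpd - hΓ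

/-- The Ricci tensor as a trace of the lowered curvature. -/
lemma ricci_eq (k l : Fin n) :
    g.ricci e k l u = ∑ m, ∑ p, g.riemann e k m l p u * g.upper e p m u := by
  refine Finset.sum_congr rfl fun m _ => ?_
  have h : g.curvMat e k m u = g.curvMat e k m u * g.gram e u * (g.gram e u)⁻¹ := by
    rw [Matrix.mul_assoc, Matrix.mul_nonsing_inv _ (g.isUnit_det_gram he hu), Matrix.mul_one]
  have h' : g.curvMat e k m u l m
      = (g.curvMat e k m u * g.gram e u * (g.gram e u)⁻¹) l m := by rw [← h]
  rw [Matrix.mul_apply] at h'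
  exact h'

end PseudoRiemannianMetric

section Components

variable {n : ℕ}

/-- A linear functional on `ℝⁿ`, given by its defining laws, that vanishes on the standard basis is
zero. -/
lemma eq_zero_of_basis {F : (Fin n → ℝ) → ℝ} (hadd : ∀ x y, F (x + y) = F x + F y)
    (hsmul : ∀ (c : ℝ) x, F (c • x) = c * F x) (h : ∀ i, F (Pi.basisFun ℝ (Fin n) i) = 0) :
    ∀ x, F x = 0 := by
  have h0 : IsLinearMap.mk' F ⟨hadd, hsmul⟩ = 0 := (Pi.basisFun ℝ (Fin n)).ext h
  exact fun x => LinearMap.congr_fun h0 x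

/-- The linear map on `ℝⁿ` with given values on the standard basis. -/
def linOfComp {W : Type*} [AddCommMonoid W] [Module ℝ W] (f : Fin n → W) : (Fin n → ℝ) →ₗ[ℝ] W :=
  (Pi.basisFun ℝ (Fin n)).constr ℝ f

lemma linOfComp_basis {W : Type*} [AddCommMonoid W] [Module ℝ W] (f : Fin n → W) (i : Fin n) :
    linOfComp f (Pi.basisFun ℝ (Fin n) i) = f i :=
  (Pi.basisFun ℝ (Fin n)).constr_basis ℝ f i

/-- Component form of `exists_quasiConstant`. -/
lemma exists_quasiConstant_components (hn : 3 < n) {g h H : Fin n → Fin n → ℝ} {α ζ : Fin n → ℝ}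
    {T : Fin n → Fin n → Fin n → Fin n → ℝ} {b : ℝ} (hb : b ≠ 0)
    (hsymm : ∀ i j, g i j = g j i) (hsymm' : ∀ i j, h i j = h j i)
    (hinv : ∀ i j, ∑ p, h i p * g p j = if i = j then 1 else 0)
    (hs : ∑ i, ∑ j, h i j * α i * α j ≠ 0)
    (hT₁ : ∀ j k l m, T j k l m = -T k j l m) (hT₂ : ∀ j k l m, T j k l m = T l m j k)
    (hα : ∀ i j k l m, α i * T j k l m + α j * T k i l m + α k * T i j l m = 0)
    (hH : ∀ q v x y z w, H q v * T x y z w + H q x * T y v z w + H q y * T v x z w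
      + α v * ((b * α q - ζ q) * (g w x * g y z - g w y * g x z)
        + b / 2 * (α z * (g w x * g y q - g w y * g x q) + α w * (g q x * g y z - g q y * g x z)))
      + α x * ((b * α q - ζ q) * (g w y * g v z - g w v * g y z)
        + b / 2 * (α z * (g w y * g v q - g w v * g y q) + α w * (g q y * g v z - g q v * g y z)))
      + α y * ((b * α q - ζ q) * (g w v * g x z - g w x * g v z)
        + b / 2 * (α z * (g w v * g x q - g w x * g v q) + α w * (g q v * g x z - g q x * g v z)))
      = 0) :
    ∃ c : ℝ, ∀ j k l m, T j k l m = c * (α j * α l * g k m - α j * α m * g k l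
      - α k * α l * g j m + α k * α m * g j l) := by
  obtain ⟨gL, bg⟩ : ∃ gL : (Fin n → ℝ) →ₗ[ℝ] (Fin n → ℝ) →ₗ[ℝ] ℝ,
      ∀ i j, gL (Pi.basisFun ℝ (Fin n) i) (Pi.basisFun ℝ (Fin n) j) = g i j :=
    ⟨linOfComp fun i => linOfComp fun j => g i j, fun i j => by simp only [linOfComp_basis]⟩
  obtain ⟨HL, bH⟩ : ∃ HL : (Fin n → ℝ) →ₗ[ℝ] (Fin n → ℝ) →ₗ[ℝ] ℝ,
      ∀ i j, HL (Pi.basisFun ℝ (Fin n) i) (Pi.basisFun ℝ (Fin n) j) = H i j :=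
    ⟨linOfComp fun i => linOfComp fun j => H i j, fun i j => by simp only [linOfComp_basis]⟩
  obtain ⟨αL, bα⟩ : ∃ αL : (Fin n → ℝ) →ₗ[ℝ] ℝ, ∀ i, αL (Pi.basisFun ℝ (Fin n) i) = α i :=
    ⟨linOfComp α, linOfComp_basis α⟩
  obtain ⟨ζL, bζ⟩ : ∃ ζL : (Fin n → ℝ) →ₗ[ℝ] ℝ, ∀ i, ζL (Pi.basisFun ℝ (Fin n) i) = ζ i :=
    ⟨linOfComp ζ, linOfComp_basis ζ⟩
  obtain ⟨TL, bT⟩ : ∃ TL : (Fin n → ℝ) →ₗ[ℝ] (Fin n → ℝ) →ₗ[ℝ] (Fin n → ℝ) →ₗ[ℝ]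
      (Fin n → ℝ) →ₗ[ℝ] ℝ, ∀ j k l m, TL (Pi.basisFun ℝ (Fin n) j) (Pi.basisFun ℝ (Fin n) k)
      (Pi.basisFun ℝ (Fin n) l) (Pi.basisFun ℝ (Fin n) m) = T j k l m :=
    ⟨linOfComp fun j => linOfComp fun k => linOfComp fun l => linOfComp fun m => T j k l m,
      fun j k l m => by simp only [linOfComp_basis]⟩
  have expand : ∀ x : Fin n → ℝ, x = ∑ i, x i • Pi.basisFun ℝ (Fin n) i := fun x =>
    ((Pi.basisFun ℝ (Fin n)).sum_repr x).symm
  have gsymm : ∀ v w, gL v w = gL w v := by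
    intro v w
    rw [← sub_eq_zero]
    revert v
    refine eq_zero_of_basis ?_ ?_ fun v => ?_
    · intros; simp only [map_add, LinearMap.add_apply]; ring
    · intros; simp only [map_smul, LinearMap.smul_apply, smul_eq_mul]; ring
    revert w
    refine eq_zero_of_basis ?_ ?_ fun w => ?_
    · intros; simp only [map_add, LinearMap.add_apply]; ring
    · intros; simp only [map_smul, LinearMap.smul_apply, smul_eq_mul]; ring
    rw [bg, bg, hsymm, sub_self]
  let a : Fin n → ℝ := fun p => ∑ j, h p j * α j
  have ha : ∀ v, gL a v = αL v := by
    intro v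
    rw [← sub_eq_zero]
    revert v
    refine eq_zero_of_basis ?_ ?_ fun v => ?_
    · intros; simp only [map_add]; ring
    · intros; simp only [map_smul, smul_eq_mul]; ring
    rw [expand a, map_sum, LinearMap.sum_apply, bα, sub_eq_zero]
    simp only [map_smul, LinearMap.smul_apply, smul_eq_mul, bg, a, Finset.sum_mul]
    rw [Finset.sum_comm]
    have : ∀ j, ∑ p, h p j * α j * g p v = α j * if j = v then 1 else 0 := by
      intro j
      rw [← hinv, Finset.mul_sum]
      exact Finset.sum_congr rfl fun p _ => by rw [hsymm' p j]; ring
    simp [this]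
  have hαa : αL a ≠ 0 := by
    rw [expand a, map_sum]
    simp only [map_smul, smul_eq_mul, bα, a, Finset.sum_mul]
    intro h0
    apply hs
    rw [← h0]
    exact Finset.sum_congr rfl fun i _ => Finset.sum_congr rfl fun j _ => by ring
  obtain ⟨c, hc⟩ := exists_quasiConstant (by simpa using Nat.succ_le_of_lt hn) gL HL αL ζL TL a hb ha hαa
    (by
      intro v hv
      funext i
      have h1 : ∀ p, ∑ j, v j * g p j = 0 := by
        intro p
        have := hv (Pi.basisFun ℝ (Fin n) p)
        rw [expand v, map_sum] at this
        simpa only [map_smul, smul_eq_mul, bg] using this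
      have h2 : ∑ j, v j * (if i = j then 1 else 0) = 0 := by
        simp only [← hinv, Finset.mul_sum]
        rw [Finset.sum_comm]
        refine Finset.sum_eq_zero fun p _ => ?_
        rw [← mul_zero (h i p), ← h1 p, Finset.mul_sum]
        exact Finset.sum_congr rfl fun j _ => by ring
      simpa using h2)
    gsymm
    (by
      intro x y z w
      rw [← sub_eq_zero]
      revert x
      refine eq_zero_of_basis ?_ ?_ fun x => ?_
      · intros; simp only [map_add, LinearMap.add_apply]; ring
      · intros; simp only [map_smul, LinearMap.smul_apply, smul_eq_mul]; ring
      revert y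
      refine eq_zero_of_basis ?_ ?_ fun y => ?_
      · intros; simp only [map_add, LinearMap.add_apply]; ring
      · intros; simp only [map_smul, LinearMap.smul_apply, smul_eq_mul]; ring
      revert z
      refine eq_zero_of_basis ?_ ?_ fun z => ?_
      · intros; simp only [map_add, LinearMap.add_apply]; ring
      · intros; simp only [map_smul, LinearMap.smul_apply, smul_eq_mul]; ring
      revert w
      refine eq_zero_of_basis ?_ ?_ fun w => ?_
      · intros; simp only [map_add]; ring
      · intros; simp only [map_smul, smul_eq_mul]; ring
      rw [bT, bT, hT₁, sub_self])
    (by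
      intro x y z w
      rw [← sub_eq_zero]
      revert x
      refine eq_zero_of_basis ?_ ?_ fun x => ?_
      · intros; simp only [map_add, LinearMap.add_apply]; ring
      · intros; simp only [map_smul, LinearMap.smul_apply, smul_eq_mul]; ring
      revert y
      refine eq_zero_of_basis ?_ ?_ fun y => ?_
      · intros; simp only [map_add, LinearMap.add_apply]; ring
      · intros; simp only [map_smul, LinearMap.smul_apply, smul_eq_mul]; ring
      revert z
      refine eq_zero_of_basis ?_ ?_ fun z => ?_
      · intros; simp only [map_add, LinearMap.add_apply]; ring
      · intros; simp only [map_smul, LinearMap.smul_apply, smul_eq_mul]; ring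
      revert w
      refine eq_zero_of_basis ?_ ?_ fun w => ?_
      · intros; simp only [map_add, LinearMap.add_apply]; ring
      · intros; simp only [map_smul, LinearMap.smul_apply, smul_eq_mul]; ring
      rw [bT, bT, hT₂, sub_self])
    (by
      intro v x y z w
      revert v
      refine eq_zero_of_basis ?_ ?_ fun v => ?_
      · intros; simp only [map_add, LinearMap.add_apply]; ring
      · intros; simp only [map_smul, LinearMap.smul_apply, smul_eq_mul]; ring
      revert x
      refine eq_zero_of_basis ?_ ?_ fun x => ?_
      · intros; simp only [map_add, LinearMap.add_apply]; ring
      · intros; simp only [map_smul, LinearMap.smul_apply, smul_eq_mul]; ring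
      revert y
      refine eq_zero_of_basis ?_ ?_ fun y => ?_
      · intros; simp only [map_add, LinearMap.add_apply]; ring
      · intros; simp only [map_smul, LinearMap.smul_apply, smul_eq_mul]; ring
      revert z
      refine eq_zero_of_basis ?_ ?_ fun z => ?_
      · intros; simp only [map_add, LinearMap.add_apply]; ring
      · intros; simp only [map_smul, LinearMap.smul_apply, smul_eq_mul]; ring
      revert w
      refine eq_zero_of_basis ?_ ?_ fun w => ?_
      · intros; simp only [map_add]; ring
      · intros; simp only [map_smul, smul_eq_mul]; ring
      simp only [bT, bα, hα])
    (by
      intro q v x y z w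
      revert q
      refine eq_zero_of_basis ?_ ?_ fun q => ?_
      · intros; simp only [map_add, LinearMap.add_apply]; ring
      · intros; simp only [map_smul, LinearMap.smul_apply, smul_eq_mul]; ring
      revert v
      refine eq_zero_of_basis ?_ ?_ fun v => ?_
      · intros; simp only [map_add, LinearMap.add_apply]; ring
      · intros; simp only [map_smul, LinearMap.smul_apply, smul_eq_mul]; ring
      revert x
      refine eq_zero_of_basis ?_ ?_ fun x => ?_
      · intros; simp only [map_add, LinearMap.add_apply]; ring
      · intros; simp only [map_smul, LinearMap.smul_apply, smul_eq_mul]; ring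
      revert y
      refine eq_zero_of_basis ?_ ?_ fun y => ?_
      · intros; simp only [map_add, LinearMap.add_apply]; ring
      · intros; simp only [map_smul, LinearMap.smul_apply, smul_eq_mul]; ring
      revert z
      refine eq_zero_of_basis ?_ ?_ fun z => ?_
      · intros; simp only [map_add, LinearMap.add_apply]; ring
      · intros; simp only [map_smul, LinearMap.smul_apply, smul_eq_mul]; ring
      revert w
      refine eq_zero_of_basis ?_ ?_ fun w => ?_
      · intros; simp only [map_add, LinearMap.add_apply]; ring
      · intros; simp only [map_smul, LinearMap.smul_apply, smul_eq_mul]; ring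
      simp only [bT, bα, bg, bH, bζ, hH])
  refine ⟨c, fun j k l m => ?_⟩
  simpa only [bT, bα, bg] using hc (Pi.basisFun ℝ (Fin n) j) (Pi.basisFun ℝ (Fin n) k)
    (Pi.basisFun ℝ (Fin n) l) (Pi.basisFun ℝ (Fin n) m)

lemma antisymm_eq_zero_fin_three {F : Fin 3 → Fin 3 → ℝ} (h : ∀ j k, F j k = -F k j)
    (h01 : F 0 1 = 0) (h02 : F 0 2 = 0) (h12 : F 1 2 = 0) (j k : Fin 3) : F j k = 0 := by
  fin_cases j <;> fin_cases k <;> simp only [Fin.zero_eta, Fin.mk_one, Fin.reduceFinMk] <;>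
    linarith [h 0 0, h 1 1, h 2 2, h 0 1, h 0 2, h 1 2]

/-- In dimension three a curvature tensor is determined by its Ricci tensor. -/
lemma weyl_eq_zero_fin_three {g h : Fin 3 → Fin 3 → ℝ} {R : Fin 3 → Fin 3 → Fin 3 → Fin 3 → ℝ}
    (hsymm : ∀ i j, g i j = g j i)
    (hinv : ∀ i j, ∑ p, h i p * g p j = if i = j then 1 else 0)
    (hR₁ : ∀ j k l m, R j k l m = -R k j l m) (hR₂ : ∀ j k l m, R j k l m = R l m j k)
    {S : Fin 3 → Fin 3 → ℝ} (hS : ∀ k l, S k l = ∑ m, ∑ p, R k m l p * h p m) (j k l m : Fin 3) :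
    R j k l m + (g j m * S k l - g k m * S j l + S j m * g k l - S k m * g j l)
      - (g j m * g k l - g k m * g j l) / 2 * (∑ k, ∑ l, h k l * S k l) = 0 := by
  have r : ∀ j l m, R j j l m = 0 := fun j l m => by linarith [hR₁ j j l m]
  have hR₃ : ∀ j k l m, R j k l m = -R j k m l := fun j k l m => by
    rw [hR₂, hR₁, hR₂ m l]
  have r' : ∀ j k l, R j k l l = 0 := fun j k l => by linarith [hR₃ j k l l]
  have hGH : Matrix.of h * Matrix.of g = 1 := by
    ext i j
    simpa [Matrix.mul_apply, Matrix.one_apply] using hinv i j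
  have hdet : (Matrix.of g).det ≠ 0 := by
    intro h0
    have := congrArg Matrix.det hGH
    rw [Matrix.det_mul, h0, mul_zero, Matrix.det_one] at this
    exact zero_ne_one this
  have hh : ∀ i j, h i j = (Matrix.of g).det⁻¹ * (Matrix.of g).adjugate i j := by
    intro i j
    have := congrFun (congrFun (Matrix.inv_eq_left_inv hGH) i) j
    rw [Matrix.inv_def] at this
    simpa using this.symm
  have hD : (Matrix.of g).det⁻¹ * (Matrix.of g).det = 1 := inv_mul_cancel₀ hdet
  clear hdet
  generalize (Matrix.of g).det⁻¹ = D at hh hD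
  simp only [Matrix.adjugate_fin_three, Matrix.of_apply] at hh
  simp only [Matrix.det_fin_three, Matrix.of_apply] at hD
  have e10 : ∀ l m, R 1 0 l m = -R 0 1 l m := hR₁ 1 0
  have e20 : ∀ l m, R 2 0 l m = -R 0 2 l m := hR₁ 2 0
  have e21 : ∀ l m, R 2 1 l m = -R 1 2 l m := hR₁ 2 1
  have f10 : ∀ j k, R j k 1 0 = -R j k 0 1 := fun j k => hR₃ j k 1 0
  have f20 : ∀ j k, R j k 2 0 = -R j k 0 2 := fun j k => hR₃ j k 2 0
  have f21 : ∀ j k, R j k 2 1 = -R j k 1 2 := fun j k => hR₃ j k 2 1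
  have p1 := hR₂ 0 2 0 1
  have p2 := hR₂ 1 2 0 1
  have p3 := hR₂ 1 2 0 2
  have g10 := hsymm 1 0
  have g20 := hsymm 2 0
  have g21 := hsymm 2 1
  rw [g10, g20, g21] at hD
  have hSc : ∑ k, ∑ l, h k l * S k l = 2 * D * (R 0 1 0 1 * g 2 2 - 2 * R 0 1 0 2 * g 1 2
      + 2 * R 0 1 1 2 * g 0 2 + R 0 2 0 2 * g 1 1 - 2 * R 0 2 1 2 * g 0 1 + R 1 2 1 2 * g 0 0) := by
    simp only [hS, hh, Fin.sum_univ_three, r, r', e10, e20, e21, f10, f20, f21, p1, p2, p3,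
      g10, g20, g21, Matrix.cons_val', Matrix.cons_val]
    linear_combination 2 * D * (R 0 1 0 1 * g 2 2 - 2 * R 0 1 0 2 * g 1 2
      + 2 * R 0 1 1 2 * g 0 2 + R 0 2 0 2 * g 1 1 - 2 * R 0 2 1 2 * g 0 1
      + R 1 2 1 2 * g 0 0) * hD
  rw [hSc]
  generalize hQ : 2 * D * (R 0 1 0 1 * g 2 2 - 2 * R 0 1 0 2 * g 1 2
      + 2 * R 0 1 1 2 * g 0 2 + R 0 2 0 2 * g 1 1 - 2 * R 0 2 1 2 * g 0 1 + R 1 2 1 2 * g 0 0) = Q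
  have main : ∀ j k : Fin 3, (j = 0 ∧ k = 1) ∨ (j = 0 ∧ k = 2) ∨ (j = 1 ∧ k = 2) →
      R j k l m + (g j m * S k l - g k m * S j l + S j m * g k l - S k m * g j l)
        - (g j m * g k l - g k m * g j l) / 2 * Q = 0 := by
    intro j k hjk
    refine antisymm_eq_zero_fin_three (F := fun l m => R j k l m + (g j m * S k l - g k m * S j l
      + S j m * g k l - S k m * g j l) - (g j m * g k l - g k m * g j l) / 2 * Q)
      (fun l m => ?_) ?_ ?_ ?_ l m
    · simp only [hR₃ j k l m]; ring
    all_goals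
      rcases hjk with ⟨rfl, rfl⟩ | ⟨rfl, rfl⟩ | ⟨rfl, rfl⟩ <;>
      · rw [← hQ]
        simp only [hS, hh, Fin.sum_univ_three, r, r', e10, e20, e21, f10, f20, f21, p1, p2, p3,
          g10, g20, g21, Matrix.cons_val', Matrix.cons_val]
        first
        | linear_combination (-R 0 1 0 1) * hD
        | linear_combination (-R 0 1 0 2) * hD
        | linear_combination (-R 0 1 1 2) * hD
        | linear_combination (-R 0 2 0 2) * hD
        | linear_combination (-R 0 2 1 2) * hD
        | linear_combination (-R 1 2 1 2) * hD
  exact antisymm_eq_zero_fin_three (F := fun j k => R j k l m + (g j m * S k l - g k m * S j l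
    + S j m * g k l - S k m * g j l) - (g j m * g k l - g k m * g j l) / 2 * Q)
    (fun j k => by simp only [hR₁ j k]; ring) (main 0 1 (by simp)) (main 0 2 (by simp))
    (main 1 2 (by simp)) j k

/-- The Ricci tensor of a tensor of quasi-constant type. -/
lemma ricci_of_quasiConstant {g h : Fin n → Fin n → ℝ} {α : Fin n → ℝ} {ψ c : ℝ}
    {R : Fin n → Fin n → Fin n → Fin n → ℝ}
    (hsymm : ∀ i j, g i j = g j i) (hsymm' : ∀ i j, h i j = h j i)
    (hinv : ∀ i j, ∑ p, h i p * g p j = if i = j then 1 else 0)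
    (hR : ∀ j k l m, R j k l m = ψ * (g m j * g k l - g m k * g j l)
      + c * (α j * α l * g k m - α j * α m * g k l - α k * α l * g j m + α k * α m * g j l))
    (k l : Fin n) :
    ∑ m, ∑ p, R k m l p * h p m
      = (c * (∑ i, ∑ j, h i j * α i * α j) - (n - 1) * ψ) * g k l
        + c * (n - 2) * (α k * α l) := by
  have hinv' : ∀ i j, ∑ p, g p i * h p j = if j = i then 1 else 0 := fun i j => by
    rw [← hinv]
    exact Finset.sum_congr rfl fun p _ => by rw [hsymm' p j]; ring
  have f₁ : ∑ m, ∑ p, g m l * (g p k * h p m) = g k l := by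
    simp [← Finset.mul_sum, hinv']
  have f₂ : ∑ m, ∑ p, g p m * h p m = (n : ℝ) := by simp [hinv']
  have f₃ : ∑ p, ∑ m, α p * (g m l * h m p) = α l := by
    simp [← Finset.mul_sum, hinv']
  have f₄ : ∑ m, ∑ p, α m * (g p k * h p m) = α k := by
    simp [← Finset.mul_sum, hinv']
  rw [Finset.sum_comm] at f₃
  have key : ∀ m p, R k m l p * h p m = ψ * (g m l * (g p k * h p m))
      - ψ * g k l * (g p m * h p m) + c * (α k * α l) * (g p m * h p m)
      - c * α k * (α p * (g m l * h m p)) - c * α l * (α m * (g p k * h p m))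
      + c * g k l * (h m p * α m * α p) := by
    intro m p
    rw [hR, hsymm m p, hsymm k p, hsymm' m p]
    ring
  have pull : ∀ (t : ℝ) (X : Fin n → Fin n → ℝ),
      ∑ m, ∑ p, t * X m p = t * ∑ m, ∑ p, X m p := fun t X => by simp only [Finset.mul_sum]
  simp only [key, Finset.sum_add_distrib, Finset.sum_sub_distrib, pull, f₁, f₂, f₃, f₄]
  ring

end Components

namespace PseudoRiemannianMetric

variable {n : ℕ} {M : Type*} [TopologicalSpace M] [ChartedSpace (Coord n) M]
  [IsManifold (𝓡 n) ∞ M] (g : PseudoRiemannianMetric n M) {A : OneForm n M} {β ψ : M → ℝ}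

/-- In dimension at least four, where `A² ≠ 0`, the reduced curvature of an extended recurrent
metric is of quasi-constant type. -/
lemma IsExtendedRecurrent.exists_reducedCurv_eq (H : g.IsExtendedRecurrent A β ψ) (hn : 3 < n)
    {e : OpenPartialHomeomorph M (Coord n)} (he : e ∈ charts n M) {u : Coord n} (hu : u ∈ e.target)
    (hA : g.normSq e A u ≠ 0) :
    ∃ c : ℝ, ∀ j k l m, g.reducedCurv e ψ j k l m u =
      c * (A.comp e j u * A.comp e l u * g.lower e k m u
        - A.comp e j u * A.comp e m u * g.lower e k l u
        - A.comp e k u * A.comp e l u * g.lower e j m u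
        + A.comp e k u * A.comp e m u * g.lower e j l u) := by
  refine exists_quasiConstant_components hn (H := fun i j => g.covOneForm e A i j u)
    (ζ := fun i => pd i (fun v => ψ (e.symm v)) u) (H.β_ne_zero (e.symm u))
    (fun i j => g.lower_symm i j u) (fun i j => g.upper_symm i j u)
    (g.sum_upper_mul_lower he hu) hA (fun j k l m => g.reducedCurv_antisymm j k l m u)
    (g.reducedCurv_pair_symm he hu) (H.wedge_eq_zero g he hu) ?_
  intro h i j k l m
  have hP := H.prolongation g he hu h i j k l m
  have hW := H.wedge_eq_zero g he hu i j k l m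
  rw [H.recurrence e he u hu, H.recurrence e he u hu, H.recurrence e he u hu] at hP
  simp only [reducedCurv, G] at hP hW ⊢
  linear_combination hP - A.comp e h u * hW

variable {g} in
/-- The curvature of an extended recurrent metric, where `A² ≠ 0`, in dimension at least four. -/
lemma IsExtendedRecurrent.curvature_eq (H : g.IsExtendedRecurrent A β ψ) (hn : 3 < n)
    {e : OpenPartialHomeomorph M (Coord n)} (he : e ∈ charts n M) {u : Coord n} (hu : u ∈ e.target)
    (hA : g.normSq e A u ≠ 0) :
    (∀ j k l m : Fin n, g.weyl e j k l m u = 0) ∧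
    (∀ k l : Fin n, g.ricci e k l u =
      g.coeffA e ψ u * g.lower e k l u + g.coeffB e ψ u * g.unitSq e A k l u) ∧
    (∀ j k l m : Fin n, g.riemann e j k l m u =
      g.coeffB e ψ u / ((n : ℝ) - 2) *
        (-(g.lower e j m u * g.unitSq e A k l u) + g.lower e k m u * g.unitSq e A j l u
          - g.lower e k l u * g.unitSq e A j m u + g.lower e j l u * g.unitSq e A k m u)
      + ψ (e.symm u) *
        (g.lower e j m u * g.lower e k l u - g.lower e j l u * g.lower e k m u)) := by
  obtain ⟨c, hc⟩ := H.exists_reducedCurv_eq g hn he hu hA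
  have hn' : (3 : ℝ) < n := by exact_mod_cast hn
  have h1 : (n : ℝ) - 1 ≠ 0 := by linarith
  have h2 : (n : ℝ) - 2 ≠ 0 := by linarith
  have hR : ∀ j k l m, g.riemann e j k l m u
      = ψ (e.symm u) * (g.lower e m j u * g.lower e k l u - g.lower e m k u * g.lower e j l u)
      + c * (A.comp e j u * A.comp e l u * g.lower e k m u
        - A.comp e j u * A.comp e m u * g.lower e k l u
        - A.comp e k u * A.comp e l u * g.lower e j m u
        + A.comp e k u * A.comp e m u * g.lower e j l u) := by
    intro j k l m
    have := hc j k l m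
    simp only [reducedCurv, G] at this
    linear_combination this
  have hRic : ∀ k l, g.ricci e k l u
      = (c * g.normSq e A u - (n - 1) * ψ (e.symm u)) * g.lower e k l u
        + c * (n - 2) * (A.comp e k u * A.comp e l u) := by
    intro k l
    rw [g.ricci_eq he hu]
    exact ricci_of_quasiConstant (fun i j => g.lower_symm i j u) (fun i j => g.upper_symm i j u)
      (g.sum_upper_mul_lower he hu) hR k l
  have hSc : g.scalar e u
      = 2 * (n - 1) * (c * g.normSq e A u) - n * (n - 1) * ψ (e.symm u) := by
    have t₁ : ∑ k, ∑ l, g.upper e k l u * g.lower e k l u = (n : ℝ) := by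
      have : ∀ k, ∑ l, g.upper e k l u * g.lower e k l u = 1 := fun k => by
        simpa only [g.lower_symm k, if_pos] using g.sum_upper_mul_lower he hu k k
      simp [this]
    have t₂ : ∑ k, ∑ l, g.upper e k l u * A.comp e k u * A.comp e l u = g.normSq e A u := rfl
    have : g.scalar e u = (c * g.normSq e A u - (n - 1) * ψ (e.symm u))
          * ∑ k, ∑ l, g.upper e k l u * g.lower e k l u
        + c * (n - 2) * ∑ k, ∑ l, g.upper e k l u * A.comp e k u * A.comp e l u := by
      simp only [scalar, hRic, Finset.mul_sum, ← Finset.sum_add_distrib]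
      exact Finset.sum_congr rfl fun k _ => Finset.sum_congr rfl fun l _ => by ring
    rw [this, t₁, t₂]
    ring
  have hB : g.coeffB e ψ u = (n - 2) * (c * g.normSq e A u) := by
    rw [coeffB, hSc]; field_simp; ring
  have hA' : g.coeffA e ψ u = c * g.normSq e A u - (n - 1) * ψ (e.symm u) := by
    rw [coeffA, hSc]; field_simp; ring
  refine ⟨fun j k l m => ?_, fun k l => ?_, fun j k l m => ?_⟩
  · rw [weyl, hSc, hR]
    simp only [hRic]
    rw [g.lower_symm m j, g.lower_symm m k]
    field_simp
    ring
  · rw [hRic, hA', hB, unitSq]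
    field_simp
  · rw [hR, hB, g.lower_symm m j, g.lower_symm m k]
    simp only [unitSq]
    field_simp
    ring

end PseudoRiemannianMetric

/-- The Weyl tensor vanishes in dimension three. -/
lemma PseudoRiemannianMetric.weyl_eq_zero_of_dim_three {M : Type*} [TopologicalSpace M]
    [ChartedSpace (Coord 3) M] [IsManifold (𝓡 3) ∞ M] (g : PseudoRiemannianMetric 3 M)
    {e : OpenPartialHomeomorph M (Coord 3)} (he : e ∈ charts 3 M) {u : Coord 3} (hu : u ∈ e.target)
    (j k l m : Fin 3) : g.weyl e j k l m u = 0 := by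
  have := weyl_eq_zero_fin_three (fun i j => g.lower_symm i j u) (g.sum_upper_mul_lower he hu)
    (fun j k l m => g.riemann_antisymm_left j k l m u) (g.riemann_pair_symm he hu)
    (g.ricci_eq he hu) j k l m
  rw [← this, weyl, scalar]
  push_cast
  ring

end ExtRec

end

theorem theorem1 {n : ℕ} (hn : 3 ≤ n)
    {M : Type*} [TopologicalSpace M] [ChartedSpace (ExtRec.Coord n) M] [IsManifold (𝓡 n) ∞ M]
    (g : ExtRec.PseudoRiemannianMetric n M) (A : ExtRec.OneForm n M) (β ψ : M → ℝ)
    (h : g.IsExtendedRecurrent A β ψ) :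
    (∀ e ∈ ExtRec.charts n M, ∀ u ∈ e.target, g.normSq e A u ≠ 0 →
      (∀ j k l m : Fin n, g.weyl e j k l m u = 0) ∧
      (3 < n →
        (∀ k l : Fin n, g.ricci e k l u =
          g.coeffA e ψ u * g.lower e k l u + g.coeffB e ψ u * g.unitSq e A k l u) ∧
        (∀ j k l m : Fin n, g.riemann e j k l m u =
          g.coeffB e ψ u / ((n : ℝ) - 2) *
            (-(g.lower e j m u * g.unitSq e A k l u) + g.lower e k m u * g.unitSq e A j l u
              - g.lower e k l u * g.unitSq e A j m u + g.lower e j l u * g.unitSq e A k m u)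
          + ψ (e.symm u) *
            (g.lower e j m u * g.lower e k l u - g.lower e j l u * g.lower e k m u)))) ∧
    ((∀ e ∈ ExtRec.charts n M, ∀ u ∈ e.target, g.normSq e A u ≠ 0) → 3 < n →
      g.IsConformallyFlat ∧ g.IsQuasiConstantCurvature) := by
  refine ⟨fun e he u hu hA => ⟨?_, fun hlt => (h.curvature_eq hlt he hu hA).2⟩, fun hA hlt =>
    ⟨fun e he u hu => (h.curvature_eq hlt he hu (hA e he u hu)).1, A, fun e he =>
      ⟨hA e he, fun u => ψ (e.symm u), fun u => -(g.coeffB e ψ u / ((n : ℝ) - 2)), ?_, ?_, ?_⟩⟩⟩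
  · obtain rfl | hlt := hn.eq_or_lt
    · exact g.weyl_eq_zero_of_dim_three he hu
    · exact (h.curvature_eq hlt he hu hA).1
  · exact ExtRec.contDiffOn_comp_chart_symm he h.smooth_ψ
  · refine ContDiffOn.neg (ContDiffOn.div_const (contDiffOn_const.mul
      ((g.contDiffOn_scalar he).add ?_)) _)
    exact ((ExtRec.contDiffOn_comp_chart_symm he h.smooth_ψ).mul contDiffOn_const).mul
      contDiffOn_const
  · intro u hu j k l m
    rw [(h.curvature_eq hlt he hu (hA e he u hu)).2.2]
    simp only [ExtRec.PseudoRiemannianMetric.G]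
    rw [g.lower_symm m j, g.lower_symm m k]
    ring
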